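/- Social Hegselmann--Krause dynamics. Let $G_{ph}=([n],E_{ph})$ be an undirected graph on $n$ agents (the physical connectivity graph), let $R>0$ be the confidence bound, and let $x[0]\in\mathbb R^n$ be the initial state. At time $k\in\{0,1,2,\dots\}$ the influence graph $\tilde G[k]$ has the edges $(i,j)\in E_{ph}$, $i\ne j$, with $|x_i[k]-x_j[k]|\le R$; the neighbourhood $\mathcal N_i[k]$ consists of $i$ and of all agents adjacent to $i$ in $\tilde G[k]$; and $$x_i[k+1]=\frac1{|\mathcal N_i[k]|}\sum_{j\in\mathcal N_i[k]}x_j[k].$$ A link break $i\text{--}j$ occurs at time $k\ge 1$ if $i$ and $j$ are adjacent in $\tilde G[k-1]$ but not in $\tilde G[k]$. The energy at time $k$ is $$\mathcal E[k]=\sum_{(i,j)\in\tilde G[k]}|x_i[k]-x_j[k]|^2+\sum_{(i,j)\notin\tilde G[k]}R^2,$$ where the sums are over ordered pairs of distinct agents that are adjacent, respectively non-adjacent, in $\tilde G[k]$. (1) The total number of link breaks during the entire opinion evolution is $O(n^5)$, regardless of $G_{ph}$ and the initial state: there is an absolute constant $C>0$ such that for all $n$, $G_{ph}$, $R>0$ and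 $x[0]$, the set of pairs $(\{i,j\},k)$ such that the link break $i\text{--}j$ occurs at time $k$ is finite and has at most $Cn^5$ elements. (2) Whenever a link break occurs at time $k+1$, the energy drops by at least $R^2/(2n^3)$ in that step: $\mathcal E[k]-\mathcal E[k+1]\ge \dfrac{R^2}{2n^3}$. -/

import Mathlib

open scoped Classical in
/-- The neighbourhood `N_i` in state `x`: the agent `i` itself, and the agents joined to `i` in the
physical connectivity graph whose opinions are within the confidence bound `R` of that of `i`. -/
noncomputable def SocialHK.neighbors {n : ℕ} (G : SimpleGraph (Fin n)) (R : ℝ) (x : Fin n → ℝ)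
    (i : Fin n) : Finset (Fin n) :=
  Finset.univ.filter fun j => j = i ∨ (G.Adj i j ∧ |x i - x j| ≤ R)

/-- One step of the dynamics: every agent moves to the average of its neighbourhood. -/
noncomputable def SocialHK.step {n : ℕ} (G : SimpleGraph (Fin n)) (R : ℝ) (x : Fin n → ℝ) :
    Fin n → ℝ :=
  fun i => (∑ j ∈ SocialHK.neighbors G R x i, x j) / ((SocialHK.neighbors G R x i).card : ℝ)

/-- The state `x[k]` at time `k`, started at `x[0] = x₀`. -/
noncomputable def SocialHK.state {n : ℕ} (G : SimpleGraph (Fin n)) (R : ℝ) (x₀ : Fin n → ℝ) :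
    ℕ → Fin n → ℝ
  | 0 => x₀
  | k + 1 => SocialHK.step G R (SocialHK.state G R x₀ k)

/-- The influence graph of a state `x` (without the self-loops): the edges of the physical
connectivity graph whose endpoints have opinions at distance at most `R`. -/
def SocialHK.influenceGraph {n : ℕ} (G : SimpleGraph (Fin n)) (R : ℝ) (x : Fin n → ℝ) :
    SimpleGraph (Fin n) where
  Adj i j := G.Adj i j ∧ |x i - x j| ≤ R
  symm := ⟨fun i j h => ⟨h.1.symm, by rw [abs_sub_comm]; exact h.2⟩⟩
  loopless := ⟨fun i h => G.loopless.irrefl i h.1⟩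

/-- The link `i -- j` breaks at time `k ≥ 1`: the agents `i` and `j` are adjacent in the influence
graph at time `k - 1` and are not adjacent in it at time `k`. -/
def SocialHK.LinkBreak {n : ℕ} (G : SimpleGraph (Fin n)) (R : ℝ) (x₀ : Fin n → ℝ)
    (i j : Fin n) (k : ℕ) : Prop :=
  1 ≤ k ∧ (SocialHK.influenceGraph G R (SocialHK.state G R x₀ (k - 1))).Adj i j ∧
    ¬ (SocialHK.influenceGraph G R (SocialHK.state G R x₀ k)).Adj i j

/-- All link breaks of the whole evolution. A link break is a pair of an undirected link `{i, j}`
and a time at which it breaks, so simultaneous breaks of different links, and breaks of the same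
link at different times, are counted separately. -/
def SocialHK.linkBreaks {n : ℕ} (G : SimpleGraph (Fin n)) (R : ℝ) (x₀ : Fin n → ℝ) :
    Set (Sym2 (Fin n) × ℕ) :=
  {b | ∃ i j : Fin n, b.1 = s(i, j) ∧ SocialHK.LinkBreak G R x₀ i j b.2}

open scoped Classical in
/-- The energy of a state `x`. The sum is over ordered pairs of distinct agents. -/
noncomputable def SocialHK.energy {n : ℕ} (G : SimpleGraph (Fin n)) (R : ℝ) (x : Fin n → ℝ) : ℝ :=
  ∑ i : Fin n, ∑ j ∈ Finset.univ.erase i,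
    if (SocialHK.influenceGraph G R x).Adj i j then |x i - x j| ^ 2 else R ^ 2

namespace SocialHK

open Finset
-- Let `u i` be the displacement of agent `i` in one step. Up to the neighbourhood size, `u` is the
-- Laplacian of the influence graph applied to `x`, and one step lowers the energy by at least `4 *
-- ∑ u i ^ 2` (`four_mul_sum_sq_displacement_le`).
--
-- For (2), a breaking link was nearly as long as `R`, or its ends moved far. A cut argument bounds
-- the length of any link by `n * ∑ |u m|`, so either way `∑ u i ^ 2` is at least `R ^ 2 / (8 * n ^
-- 3)` (`sq_le_of_break`).
--
-- For (1), many links may change at once, so (2) alone is too weak. Comparing the Laplacians before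
-- and after a step, each changed link contributes `±R` up to a small error, with sign fixed by
-- which end has the larger displacement (`abs_sub_add_changeFlow_le`). The changes thus form an
-- acyclic flow whose divergence is controlled by the displacements of two consecutive steps, while
-- acyclicity bounds the number of links by the divergence (`card_linkChange_le`). The number of
-- changes is therefore at most a multiple of `n ^ 3 / R ^ 2` times a two-step energy drop, and the
-- total energy is at most `n ^ 2 * R ^ 2`.
open scoped Classical in
/-- The adjacency matrix of the influence graph. -/
noncomputable def adjWeight {n : ℕ} (G : SimpleGraph (Fin n)) (R : ℝ) (x : Fin n → ℝ)
    (i j : Fin n) : ℝ :=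
  if (influenceGraph G R x).Adj i j then 1 else 0

/-- The amount by which each agent moves down in one step. -/
noncomputable def displacement {n : ℕ} (G : SimpleGraph (Fin n)) (R : ℝ) (x : Fin n → ℝ)
    (i : Fin n) : ℝ :=
  x i - step G R x i

/-! ### The Laplacian of the influence graph -/

section

variable {n : ℕ} (G : SimpleGraph (Fin n)) (R : ℝ) (x : Fin n → ℝ)

theorem adjWeight_comm (i j : Fin n) : adjWeight G R x i j = adjWeight G R x j i := by
  classical
  unfold adjWeight
  exact if_congr ((influenceGraph G R x).adj_comm i j) rfl rfl

theorem adjWeight_self (i : Fin n) : adjWeight G R x i i = 0 := by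
  simp [adjWeight]

theorem adjWeight_nonneg (i j : Fin n) : 0 ≤ adjWeight G R x i j := by
  unfold adjWeight; split_ifs <;> norm_num

/-- A sum over a neighbourhood splits into the agent's own term and its influence graph part. -/
theorem sum_neighbors (f : Fin n → ℝ) (i : Fin n) :
    ∑ j ∈ neighbors G R x i, f j = f i + ∑ j, adjWeight G R x i j * f j := by
  classical
  have h : ∀ j, (if j = i ∨ (G.Adj i j ∧ |x i - x j| ≤ R) then f j else 0) =
      (if j = i then f j else 0) + adjWeight G R x i j * f j := by
    intro j
    by_cases hj : j = i
    · subst hj; simp [adjWeight_self]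
    · by_cases hA : G.Adj i j ∧ |x i - x j| ≤ R <;> simp [hj, hA, adjWeight, influenceGraph]
  unfold neighbors
  rw [sum_filter]
  calc _ = ∑ j, ((if j = i then f j else 0) + adjWeight G R x i j * f j) :=
        sum_congr rfl fun j _ => by rw [← h j]
    _ = _ := by rw [sum_add_distrib]; simp

theorem card_neighbors (i : Fin n) :
    ((neighbors G R x i).card : ℝ) = 1 + ∑ j, adjWeight G R x i j := by
  simpa using sum_neighbors G R x (fun _ => 1) i

theorem card_neighbors_pos (i : Fin n) : (0 : ℝ) < (neighbors G R x i).card := by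
  rw [card_neighbors]
  have := sum_nonneg fun j (_ : j ∈ univ) => adjWeight_nonneg G R x i j
  linarith

theorem card_neighbors_le (i : Fin n) : ((neighbors G R x i).card : ℝ) ≤ n := by
  have := card_le_univ (neighbors G R x i)
  rw [Fintype.card_fin] at this
  exact_mod_cast this

/-- The displacement is the graph Laplacian applied to `x`, divided by the neighbourhood size. -/
theorem card_mul_displacement (i : Fin n) :
    ((neighbors G R x i).card : ℝ) * displacement G R x i =
      ∑ j, adjWeight G R x i j * (x i - x j) := by
  have h := (card_neighbors_pos G R x i).ne'
  have h2 : ((neighbors G R x i).card : ℝ) * displacement G R x i =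
      (neighbors G R x i).card * x i - ∑ j ∈ neighbors G R x i, x j := by
    unfold displacement step
    field_simp
  rw [h2, sum_neighbors, card_neighbors]
  simp only [mul_sub, sum_sub_distrib, ← sum_mul]
  ring

end

/-- Summation by parts: used over `ℝ` for the Laplacian and over `ℤ` for the flow of changing links.
-/
theorem sum_antisymm_mul_sub {ι K : Type*} [Fintype ι] [CommRing K] (B : ι → ι → K)
    (hB : ∀ i j, B i j = -B j i) (w : ι → K) :
    ∑ i, ∑ j, B i j * (w i - w j) = 2 * ∑ i, w i * ∑ j, B i j := by
  have h1 : ∑ i, ∑ j, B i j * w i = ∑ i, w i * ∑ j, B i j := by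
    simp only [mul_sum, mul_comm]
  have h2 : ∑ i, ∑ j, B i j * w j = -∑ i, w i * ∑ j, B i j := by
    rw [← h1, sum_comm]
    simp only [← sum_neg_distrib]
    exact sum_congr rfl fun i _ => sum_congr rfl fun j _ => by rw [hB j i]; ring
  simp only [mul_sub, sum_sub_distrib, h1, h2]
  ring

/-! ### Energy decrease, and its size at a link break -/

section

variable {n : ℕ} (G : SimpleGraph (Fin n)) (R : ℝ) (x : Fin n → ℝ)

theorem sum_adjWeight_mul_sub (w : Fin n → ℝ) :
    ∑ i, ∑ j, adjWeight G R x i j * (x i - x j) * (w i - w j) =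
      2 * ∑ i, w i * ((neighbors G R x i).card * displacement G R x i) := by
  rw [sum_antisymm_mul_sub (fun i j => adjWeight G R x i j * (x i - x j))]
  · simp only [card_mul_displacement]
  · intro i j
    rw [adjWeight_comm]; ring

/-- Without the link changes, the energy of one step drops by the Dirichlet form's difference. -/
theorem dirichlet_sub_le_energy_sub (hR : 0 < R) (y : Fin n → ℝ) :
    ∑ i, ∑ j, adjWeight G R x i j * ((x i - x j) ^ 2 - (y i - y j) ^ 2) ≤
      energy G R x - energy G R y := by
  classical
  unfold energy
  rw [← sum_sub_distrib]
  refine sum_le_sum fun i _ => ?_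
  rw [← sum_sub_distrib, ← sum_erase univ (a := i) (by simp)]
  refine sum_le_sum fun j _ => ?_
  simp only [adjWeight, sq_abs, influenceGraph]
  -- A physical edge contributes the minimum of its squared length and `R ^ 2`, so relinking can
  -- only lower the energy; a non-edge always contributes `R ^ 2`.
  by_cases hG : G.Adj i j
  · by_cases hx : |x i - x j| ≤ R <;> by_cases hy : |y i - y j| ≤ R <;> simp only [hG, hx, hy]
    · simp
    · have : R ^ 2 ≤ (y i - y j) ^ 2 := by
        rw [← sq_abs (y i - y j)]
        exact pow_le_pow_left₀ hR.le (not_le.1 hy).le 2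
      simp; linarith
    · have : (y i - y j) ^ 2 ≤ R ^ 2 := by
        rw [← sq_abs (y i - y j)]
        exact pow_le_pow_left₀ (abs_nonneg _) hy 2
      simp; linarith
    · simp
  · simp [hG]

/-- The surplus comes from the self-loop: the neighbourhood size exceeds the degree by one, and the
degree terms cancel. -/
theorem four_mul_sum_sq_displacement_le (hR : 0 < R) :
    4 * ∑ i, displacement G R x i ^ 2 ≤ energy G R x - energy G R (step G R x) := by
  refine le_trans ?_ (dirichlet_sub_le_energy_sub G R x hR _)
  set u := displacement G R x with hu
  have hs : ∀ i, step G R x i = x i - u i := fun i => by simp [hu, displacement]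
  -- This is `(u i - u j) ^ 2 ≤ 2 * u i ^ 2 + 2 * u j ^ 2`, with defect `(u i + u j) ^ 2`.
  have h1 : ∀ i j, 2 * (adjWeight G R x i j * (x i - x j) * (u i - u j)) -
      2 * (adjWeight G R x i j * u i ^ 2) - 2 * (adjWeight G R x j i * u j ^ 2) ≤
      adjWeight G R x i j * ((x i - x j) ^ 2 - (step G R x i - step G R x j) ^ 2) := by
    intro i j
    rw [hs, hs, adjWeight_comm G R x j i]
    have := mul_nonneg (adjWeight_nonneg G R x i j) (sq_nonneg (u i + u j))
    nlinarith
  refine le_trans (le_of_eq ?_) (sum_le_sum fun i _ => sum_le_sum fun j _ => h1 i j)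
  simp only [sum_sub_distrib, ← mul_sum]
  rw [sum_adjWeight_mul_sub, sum_comm (f := fun i j => adjWeight G R x j i * u j ^ 2)]
  simp only [← sum_mul, card_neighbors]
  rw [← hu]
  have h2 : ∑ i, u i * ((1 + ∑ j, adjWeight G R x i j) * u i) =
      ∑ i, u i ^ 2 + ∑ i, (∑ j, adjWeight G R x i j) * u i ^ 2 := by
    rw [← sum_add_distrib]
    exact sum_congr rfl fun i _ => by ring
  rw [h2]
  ring

/-- Across the cut just below `x i`, the total displacement balances the length of any link. -/
theorem sub_le_card_mul_sum_abs_displacement {i j : Fin n}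
    (h : (influenceGraph G R x).Adj i j) (hij : x j < x i) :
    x i - x j ≤ n * ∑ m, |displacement G R x m| := by
  classical
  -- Testing the Laplacian against the indicator of a cut makes all terms nonnegative, and the given
  -- link appears in both orientations.
  set w : Fin n → ℝ := fun m => if x i ≤ x m then 1 else 0 with hw
  have hnn : ∀ a b, 0 ≤ adjWeight G R x a b * (x a - x b) * (w a - w b) := by
    intro a b
    rw [mul_assoc]
    refine mul_nonneg (adjWeight_nonneg G R x a b) ?_
    simp only [hw]
    split_ifs with h1 h2 h2
    · simp
    · simp; linarith
    · simp; linarith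
    · simp
  have hA : adjWeight G R x i j = 1 := by simp [adjWeight, h]
  have hA' : adjWeight G R x j i = 1 := by rw [adjWeight_comm, hA]
  have hwi : w i = 1 := by simp [hw]
  have hwj : w j = 0 := by simp [hw, hij]
  have hne : i ≠ j := by rintro rfl; exact lt_irrefl _ hij
  have h1 : 2 * (x i - x j) ≤ ∑ a, ∑ b, adjWeight G R x a b * (x a - x b) * (w a - w b) := by
    have hi := single_le_sum (fun b _ => hnn i b) (mem_univ j)
    have hj := single_le_sum (fun b _ => hnn j b) (mem_univ i)
    have h2 : ∑ a ∈ {i, j}, ∑ b, adjWeight G R x a b * (x a - x b) * (w a - w b) ≤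
        ∑ a, ∑ b, adjWeight G R x a b * (x a - x b) * (w a - w b) :=
      sum_le_sum_of_subset_of_nonneg (subset_univ _)
        fun a _ _ => sum_nonneg fun b _ => hnn a b
    rw [sum_pair hne] at h2
    simp only [hA, hA', hwi, hwj] at hi hj h2
    linarith
  rw [sum_adjWeight_mul_sub] at h1
  have h2 : ∑ m, w m * ((neighbors G R x m).card * displacement G R x m) ≤
      n * ∑ m, |displacement G R x m| := by
    rw [mul_sum]
    refine sum_le_sum fun m _ => ?_
    have h3 : ((neighbors G R x m).card : ℝ) * displacement G R x m ≤
        n * |displacement G R x m| :=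
      (mul_le_mul_of_nonneg_left (le_abs_self _) (Nat.cast_nonneg _)).trans
        (mul_le_mul_of_nonneg_right (card_neighbors_le G R x m) (abs_nonneg _))
    have h4 : 0 ≤ (n : ℝ) * |displacement G R x m| := by positivity
    simp only [hw]
    split_ifs <;> linarith
  linarith

theorem abs_sub_le_card_mul_sum_abs_displacement {i j : Fin n}
    (h : (influenceGraph G R x).Adj i j) :
    |x i - x j| ≤ n * ∑ m, |displacement G R x m| := by
  rcases lt_trichotomy (x i) (x j) with hij | hij | hij
  · rw [abs_sub_comm, abs_of_pos (sub_pos.2 hij)]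
    exact sub_le_card_mul_sum_abs_displacement G R x h.symm hij
  · rw [hij, sub_self, abs_zero]
    positivity
  · rw [abs_of_pos (sub_pos.2 hij)]
    exact sub_le_card_mul_sum_abs_displacement G R x h hij

theorem sq_sum_abs_le (u : Fin n → ℝ) : (∑ m, |u m|) ^ 2 ≤ n * ∑ m, u m ^ 2 := by
  simpa using sq_sum_le_card_mul_sum_sq (s := univ) (f := fun m => |u m|)

theorem sq_le_of_break (hR : 0 < R) {i j : Fin n} (h : (influenceGraph G R x).Adj i j)
    (h' : ¬ (influenceGraph G R (step G R x)).Adj i j) :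
    R ^ 2 ≤ 8 * (n : ℝ) ^ 3 * ∑ m, displacement G R x m ^ 2 := by
  set u := displacement G R x with hu
  have hs : ∀ i, step G R x i = x i - u i := fun i => by simp [hu, displacement]
  have hlt : R < |step G R x i - step G R x j| := by
    by_contra hc
    exact h' ⟨h.1, not_lt.1 hc⟩
  have hne : i ≠ j := h.ne
  have hn : (1 : ℝ) ≤ n := by exact_mod_cast Fin.pos i
  have h1 := abs_sub_le_card_mul_sum_abs_displacement G R x h
  rw [← hu] at h1
  have h2 := sq_sum_abs_le u
  have h3 : u i ^ 2 + u j ^ 2 ≤ ∑ m, u m ^ 2 := by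
    rw [← sum_pair (f := fun m => u m ^ 2) hne]
    exact sum_le_sum_of_subset_of_nonneg (subset_univ _) fun _ _ _ => sq_nonneg _
  set U := ∑ m, u m ^ 2
  have h4 : (x i - x j) ^ 2 ≤ (n : ℝ) ^ 3 * U := by
    rw [← sq_abs (x i - x j)]
    calc |x i - x j| ^ 2 ≤ (n * ∑ m, |u m|) ^ 2 := pow_le_pow_left₀ (abs_nonneg _) h1 2
      _ = (n : ℝ) ^ 2 * (∑ m, |u m|) ^ 2 := by ring
      _ ≤ (n : ℝ) ^ 2 * (n * U) := by gcongr
      _ = _ := by ring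
  have h5 : R ^ 2 ≤ (step G R x i - step G R x j) ^ 2 := by
    rw [← sq_abs (step G R x i - step G R x j)]
    exact pow_le_pow_left₀ hR.le hlt.le 2
  rw [hs, hs] at h5
  have h6 : (1 : ℝ) ≤ (n : ℝ) ^ 3 := one_le_pow₀ hn
  have hU : 0 ≤ U := sum_nonneg fun _ _ => sq_nonneg _
  have h7 : U ≤ (n : ℝ) ^ 3 * U := le_mul_of_one_le_left hU h6
  nlinarith [sq_nonneg (x i - x j + (u i - u j)), sq_nonneg (u i + u j)]

end

/-! ### Counting all link changes in one step -/

section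

variable {n : ℕ} (G : SimpleGraph (Fin n)) (R : ℝ) (x : Fin n → ℝ)

/-- The status of the link between two agents changes in one step. -/
def LinkChange (i j : Fin n) : Prop :=
  ¬ ((influenceGraph G R x).Adj i j ↔ (influenceGraph G R (step G R x)).Adj i j)

theorem linkChange_comm (i j : Fin n) : LinkChange G R x i j ↔ LinkChange G R x j i := by
  simp only [LinkChange, SimpleGraph.adj_comm]

open scoped Classical in
/-- The changing links, oriented towards the smaller displacement. -/
noncomputable def changeFlow (i j : Fin n) : ℤ :=
  if LinkChange G R x i j then
    if displacement G R x j < displacement G R x i then 1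
    else if displacement G R x i < displacement G R x j then -1 else 0
  else 0

theorem changeFlow_antisymm (i j : Fin n) : changeFlow G R x i j = -changeFlow G R x j i := by
  unfold changeFlow
  rw [linkChange_comm G R x j i]
  rcases lt_trichotomy (displacement G R x i) (displacement G R x j) with h | h | h
  · split_ifs <;> simp [h, h.not_gt] at *
  · simp [h]
  · split_ifs <;> simp [h, h.not_gt] at *

theorem displacement_ne_of_linkChange {i j : Fin n} (h : LinkChange G R x i j) :
    displacement G R x i ≠ displacement G R x j := by
  intro he
  apply h
  have : x i - x j = step G R x i - step G R x j := by
    unfold displacement at he; linarith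
  simp only [influenceGraph, this]

/-- The signed length crosses `R` or `-R` during the step, so at a change the surviving term is
within `|u i - u j|` of that threshold. Breaks and creations get the same sign, since a creation
enters with a minus but crosses the opposite threshold. -/
theorem abs_sub_add_changeFlow_le (i j : Fin n) :
    |adjWeight G R x i j * (x i - x j) -
        adjWeight G R (step G R x) i j * (step G R x i - step G R x j) +
        R * (changeFlow G R x i j : ℝ)| ≤
      |displacement G R x i - displacement G R x j| := by
  set u := displacement G R x with hu
  have hs : step G R x i - step G R x j = x i - x j - (u i - u j) := by
    simp only [hu, displacement]; ring
  have hX : (influenceGraph G R x).Adj i j ↔ G.Adj i j ∧ |x i - x j| ≤ R := Iff.rfl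
  have hY : (influenceGraph G R (step G R x)).Adj i j ↔
      G.Adj i j ∧ |x i - x j - (u i - u j)| ≤ R := by rw [← hs]; rfl
  unfold adjWeight changeFlow LinkChange
  rw [← hu, hs]
  by_cases hP : (influenceGraph G R x).Adj i j <;>
    by_cases hQ : (influenceGraph G R (step G R x)).Adj i j
  · simp [hP, hQ]
  · have hx := (hX.1 hP).2
    have hy : ¬ |x i - x j - (u i - u j)| ≤ R := fun h => hQ (hY.2 ⟨(hX.1 hP).1, h⟩)
    simp only [hP, hQ, if_true, if_false, iff_false, not_true, not_false_iff]
    rcases lt_trichotomy (u i) (u j) with h | h | h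
    · rw [abs_le] at hx
      have hy' : R < x i - x j - (u i - u j) := by
        rcases lt_abs.1 (not_le.1 hy) with h1 | h1 <;> linarith
      rw [if_neg h.not_gt, if_pos h, abs_of_neg (sub_neg.2 h), abs_le]
      push_cast
      constructor <;> linarith
    · rw [h, sub_self, sub_zero] at hy
      exact absurd hx hy
    · rw [abs_le] at hx
      have hy' : R < -(x i - x j - (u i - u j)) := by
        rcases lt_abs.1 (not_le.1 hy) with h1 | h1 <;> linarith
      rw [if_pos h, abs_of_pos (sub_pos.2 h), abs_le]
      push_cast
      constructor <;> linarith
  · have hy := (hY.1 hQ).2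
    have hx : ¬ |x i - x j| ≤ R := fun h => hP (hX.2 ⟨(hY.1 hQ).1, h⟩)
    simp only [hP, hQ, if_true, if_false, iff_true, not_false_iff]
    rcases lt_trichotomy (u i) (u j) with h | h | h
    · rw [abs_le] at hy
      have hx' : R < -(x i - x j) := by
        rcases lt_abs.1 (not_le.1 hx) with h1 | h1 <;> linarith
      rw [if_neg h.not_gt, if_pos h, abs_of_neg (sub_neg.2 h), abs_le]
      push_cast
      constructor <;> linarith
    · rw [h, sub_self, sub_zero] at hy
      exact absurd hy hx
    · rw [abs_le] at hy
      have hx' : R < x i - x j := by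
        rcases lt_abs.1 (not_le.1 hx) with h1 | h1 <;> linarith
      rw [if_pos h, abs_of_pos (sub_pos.2 h), abs_le]
      push_cast
      constructor <;> linarith
  · simp [hP, hQ]

/-- The net change of the links at an agent is controlled by the displacements before and after. -/
theorem mul_abs_sum_changeFlow_le (hR : 0 < R) (i : Fin n) :
    R * |((∑ j, changeFlow G R x i j : ℤ) : ℝ)| ≤
      2 * n * |displacement G R x i| + n * |displacement G R (step G R x) i| +
        ∑ j, |displacement G R x j| := by
  set u := displacement G R x with hu
  set v := displacement G R (step G R x) with hv
  have h1 : |(neighbors G R x i).card * u i - (neighbors G R (step G R x) i).card * v i +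
      R * ((∑ j, changeFlow G R x i j : ℤ) : ℝ)| ≤ n * |u i| + ∑ j, |u j| := by
    rw [hu, hv, card_mul_displacement, card_mul_displacement, ← hu, ← sum_sub_distrib,
      Int.cast_sum, mul_sum, ← sum_add_distrib]
    refine (abs_sum_le_sum_abs _ _).trans ?_
    have : (n : ℝ) * |u i| + ∑ j, |u j| = ∑ j, (|u i| + |u j|) := by
      rw [sum_add_distrib]; simp
    rw [this]
    exact sum_le_sum fun j _ => (abs_sub_add_changeFlow_le G R x i j).trans (abs_sub _ _)
  have h2 : |((neighbors G R x i).card : ℝ) * u i| ≤ n * |u i| := by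
    rw [abs_mul, Nat.abs_cast]
    exact mul_le_mul_of_nonneg_right (card_neighbors_le _ _ _ _) (abs_nonneg _)
  have h3 : |((neighbors G R (step G R x) i).card : ℝ) * v i| ≤ n * |v i| := by
    rw [abs_mul, Nat.abs_cast]
    exact mul_le_mul_of_nonneg_right (card_neighbors_le _ _ _ _) (abs_nonneg _)
  rw [← abs_of_pos hR, ← abs_mul, abs_of_pos hR]
  rw [abs_le] at h1 h2 h3 ⊢
  constructor <;> linarith

theorem sq_mul_sum_sq_changeFlow_le (hR : 0 < R) :
    R ^ 2 * ∑ i, ((∑ j, changeFlow G R x i j : ℤ) : ℝ) ^ 2 ≤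
      15 * (n : ℝ) ^ 2 * (∑ i, displacement G R x i ^ 2 +
        ∑ i, displacement G R (step G R x) i ^ 2) := by
  set u := displacement G R x with hu
  set v := displacement G R (step G R x) with hv
  set S := ∑ j, |u j| with hS
  have h1 : ∀ i, R ^ 2 * ((∑ j, changeFlow G R x i j : ℤ) : ℝ) ^ 2 ≤
      12 * (n : ℝ) ^ 2 * u i ^ 2 + 3 * (n : ℝ) ^ 2 * v i ^ 2 + 3 * S ^ 2 := by
    intro i
    have h := mul_abs_sum_changeFlow_le G R x hR i
    rw [← hu, ← hv, ← hS] at h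
    have h2 := pow_le_pow_left₀ (mul_nonneg hR.le (abs_nonneg _)) h 2
    rw [mul_pow, sq_abs] at h2
    refine h2.trans ?_
    rw [← sq_abs (u i), ← sq_abs (v i)]
    nlinarith [sq_nonneg (2 * n * |u i| - n * |v i|), sq_nonneg (2 * n * |u i| - S),
      sq_nonneg (n * |v i| - S)]
  have h2 : S ^ 2 ≤ n * ∑ i, u i ^ 2 := sq_sum_abs_le u
  have hV : 0 ≤ ∑ i, v i ^ 2 := sum_nonneg fun _ _ => sq_nonneg _
  calc _ = ∑ i, R ^ 2 * ((∑ j, changeFlow G R x i j : ℤ) : ℝ) ^ 2 := mul_sum _ _ _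
    _ ≤ ∑ i, (12 * (n : ℝ) ^ 2 * u i ^ 2 + 3 * (n : ℝ) ^ 2 * v i ^ 2 + 3 * S ^ 2) :=
        sum_le_sum fun i _ => h1 i
    _ = 12 * (n : ℝ) ^ 2 * ∑ i, u i ^ 2 + 3 * (n : ℝ) ^ 2 * ∑ i, v i ^ 2 + n * (3 * S ^ 2) := by
        simp only [sum_add_distrib, ← mul_sum]; simp; ring
    _ ≤ 12 * (n : ℝ) ^ 2 * ∑ i, u i ^ 2 + 3 * (n : ℝ) ^ 2 * ∑ i, v i ^ 2 +
          n * (3 * (n * ∑ i, u i ^ 2)) := by gcongr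
    _ ≤ _ := by nlinarith [mul_nonneg (sq_nonneg (n : ℝ)) hV]

open scoped Classical in
/-- The changing links form an acyclic flow, so each path of it has at most `n` links. -/
theorem card_linkChange_le :
    ((univ.filter fun p : Fin n × Fin n => LinkChange G R x p.1 p.2).card : ℤ) ≤
      2 * n * ∑ i, (∑ j, changeFlow G R x i j) ^ 2 := by
  set u := displacement G R x with hu
  -- The rank by displacement is a potential in `[0, n]` that drops by at least one along each
  -- changing link.
  set r : Fin n → ℤ := fun a => ((univ.filter fun m => u m < u a).card : ℤ) with hr
  have hr0 : ∀ a, 0 ≤ r a := fun a => by simp [hr]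
  have hrn : ∀ a, r a ≤ n := fun a => by
    have := card_le_univ (univ.filter fun m => u m < u a)
    rw [Fintype.card_fin] at this
    simp only [hr]; exact_mod_cast this
  have hlt : ∀ a b, u a < u b → r a + 1 ≤ r b := by
    intro a b hab
    have : (univ.filter fun m => u m < u a) ⊂ (univ.filter fun m => u m < u b) := by
      refine (ssubset_iff_of_subset fun m => ?_).2 ⟨a, by simpa using hab, by simp⟩
      simp only [mem_filter, mem_univ, true_and]
      exact fun h => h.trans hab
    have := card_lt_card this
    simp only [hr]; exact_mod_cast this
  have h1 : ∀ a b, (if LinkChange G R x a b then (1 : ℤ) else 0) ≤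
      changeFlow G R x a b * (r a - r b) := by
    intro a b
    by_cases h : LinkChange G R x a b
    · rcases lt_or_gt_of_ne (displacement_ne_of_linkChange G R x h) with hab | hab
      · have := hlt a b hab
        simp only [changeFlow, h, hab, hab.not_gt]; simp; linarith
      · have := hlt b a hab
        simp only [changeFlow, h, hab]; simp; linarith
    · simp [changeFlow, h]
  calc _ = ∑ a, ∑ b, (if LinkChange G R x a b then (1 : ℤ) else 0) := by
        rw [card_filter, ← univ_product_univ, sum_product]; push_cast; rfl
    _ ≤ ∑ a, ∑ b, changeFlow G R x a b * (r a - r b) :=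
        sum_le_sum fun a _ => sum_le_sum fun b _ => h1 a b
    _ = 2 * ∑ a, r a * ∑ b, changeFlow G R x a b :=
        sum_antisymm_mul_sub _ (changeFlow_antisymm G R x) r
    _ ≤ 2 * ∑ a, n * (∑ b, changeFlow G R x a b) ^ 2 := by
        refine mul_le_mul_of_nonneg_left (sum_le_sum fun a _ => ?_) zero_le_two
        set D := ∑ b, changeFlow G R x a b
        -- Integrality of the divergence gives the passage to squares.
        have hD : D ≤ D ^ 2 := Int.le_self_sq D
        calc r a * D ≤ r a * D ^ 2 := mul_le_mul_of_nonneg_left hD (hr0 a)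
          _ ≤ n * D ^ 2 := mul_le_mul_of_nonneg_right (hrn a) (sq_nonneg D)
    _ = _ := by rw [← mul_sum]; ring

open scoped Classical in
theorem sq_mul_card_linkChange_le (hR : 0 < R) :
    R ^ 2 * ((univ.filter fun p : Fin n × Fin n => LinkChange G R x p.1 p.2).card : ℝ) ≤
      15 / 2 * (n : ℝ) ^ 3 * (energy G R x - energy G R (step G R (step G R x))) := by
  have h1 : ((univ.filter fun p : Fin n × Fin n => LinkChange G R x p.1 p.2).card : ℝ) ≤
      2 * n * ∑ i, ((∑ j, changeFlow G R x i j : ℤ) : ℝ) ^ 2 := by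
    exact_mod_cast card_linkChange_le G R x
  have h2 := sq_mul_sum_sq_changeFlow_le G R x hR
  have h3 := four_mul_sum_sq_displacement_le G R x hR
  have h4 := four_mul_sum_sq_displacement_le G R (step G R x) hR
  set U := ∑ i, displacement G R x i ^ 2
  set V := ∑ i, displacement G R (step G R x) i ^ 2
  calc _ ≤ R ^ 2 * (2 * n * ∑ i, ((∑ j, changeFlow G R x i j : ℤ) : ℝ) ^ 2) := by gcongr
    _ = 2 * n * (R ^ 2 * ∑ i, ((∑ j, changeFlow G R x i j : ℤ) : ℝ) ^ 2) := by ring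
    _ ≤ 2 * n * (15 * (n : ℝ) ^ 2 * (U + V)) := by gcongr
    _ = 15 / 2 * (n : ℝ) ^ 3 * (4 * U + 4 * V) := by ring
    _ ≤ _ := by gcongr; linarith

theorem energy_nonneg : 0 ≤ energy G R x := by
  classical
  unfold energy
  refine sum_nonneg fun i _ => sum_nonneg fun j _ => ?_
  split_ifs <;> positivity

theorem energy_le : energy G R x ≤ (n : ℝ) ^ 2 * R ^ 2 := by
  classical
  unfold energy
  calc _ ≤ ∑ i : Fin n, ∑ j ∈ univ.erase i, R ^ 2 := by
        refine sum_le_sum fun i _ => sum_le_sum fun j _ => ?_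
        split_ifs with h
        · exact pow_le_pow_left₀ (abs_nonneg _) h.2 2
        · exact le_rfl
    _ ≤ ∑ i : Fin n, ∑ j : Fin n, R ^ 2 :=
        sum_le_sum fun i _ => sum_le_sum_of_subset_of_nonneg (subset_univ _)
          fun _ _ _ => sq_nonneg _
    _ = _ := by simp; ring

end

/-! ### Summation over time -/

section

variable {n : ℕ} (G : SimpleGraph (Fin n)) (R : ℝ) (x₀ : Fin n → ℝ)

-- Two-step drops telescope to at most `E 0 + E 1`, hence the factor 2.
open scoped Classical in
theorem sum_card_linkChange_le (hR : 0 < R) (K : ℕ) :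
    (∑ k ∈ range K, (univ.filter fun p : Fin n × Fin n =>
      LinkChange G R (state G R x₀ k) p.1 p.2).card : ℝ) ≤ 15 * (n : ℝ) ^ 5 := by
  set E : ℕ → ℝ := fun k => energy G R (state G R x₀ k) with hE
  have h1 : R ^ 2 * (∑ k ∈ range K, (univ.filter fun p : Fin n × Fin n =>
      LinkChange G R (state G R x₀ k) p.1 p.2).card : ℝ) ≤
      15 / 2 * (n : ℝ) ^ 3 * ∑ k ∈ range K, (E k - E (k + 2)) := by
    rw [mul_sum, mul_sum]
    exact sum_le_sum fun k _ => sq_mul_card_linkChange_le G R (state G R x₀ k) hR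
  have h2 : ∑ k ∈ range K, (E k - E (k + 2)) = E 0 + E 1 - E K - E (K + 1) := by
    clear h1
    induction K with
    | zero => simp
    | succ K ih => rw [sum_range_succ, ih]; ring
  have h3 : ∑ k ∈ range K, (E k - E (k + 2)) ≤ 2 * ((n : ℝ) ^ 2 * R ^ 2) := by
    rw [h2]
    have := energy_le G R (state G R x₀ 0)
    have := energy_le G R (state G R x₀ 1)
    have := energy_nonneg G R (state G R x₀ K)
    have := energy_nonneg G R (state G R x₀ (K + 1))
    simp only [hE]; linarith
  refine le_of_mul_le_mul_left (h1.trans ?_) (pow_pos hR 2)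
  calc _ ≤ 15 / 2 * (n : ℝ) ^ 3 * (2 * ((n : ℝ) ^ 2 * R ^ 2)) := by gcongr
    _ = _ := by ring

theorem card_le_of_subset_linkBreaks (hR : 0 < R) (s : Finset (Sym2 (Fin n) × ℕ))
    (hs : (s : Set (Sym2 (Fin n) × ℕ)) ⊆ linkBreaks G R x₀) :
    (s.card : ℝ) ≤ 15 * (n : ℝ) ^ 5 := by
  classical
  set K := s.sup Prod.snd
  set T := (range K).sigma fun k => univ.filter fun p : Fin n × Fin n =>
      LinkChange G R (state G R x₀ k) p.1 p.2 with hT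
  have h : s ⊆ T.image fun q => (s(q.2.1, q.2.2), q.1 + 1) := by
    rintro ⟨e, k⟩ hb
    obtain ⟨i, j, he, hk, h1, h2⟩ := hs hb
    have hle : k ≤ K := le_sup (f := Prod.snd) hb
    simp only at he hk h1 h2
    -- A break at time `k + 1` is a link change of the state at time `k`.
    obtain ⟨k, rfl⟩ : ∃ m, k = m + 1 := ⟨k - 1, by omega⟩
    refine mem_image.2 ⟨⟨k, i, j⟩, ?_, by simp [he]⟩
    simp only [hT, mem_sigma, mem_range, mem_filter, mem_univ, true_and]
    exact ⟨hle, fun hc => h2 (hc.1 h1)⟩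
  have h1 := (card_le_card h).trans card_image_le
  rw [hT, card_sigma] at h1
  refine le_trans ?_ (sum_card_linkChange_le G R x₀ hR K)
  exact_mod_cast h1

theorem finite_linkBreaks (hR : 0 < R) : (linkBreaks G R x₀).Finite := by
  by_contra hinf
  obtain ⟨s, hs, hc⟩ := Set.Infinite.exists_subset_card_eq hinf (15 * n ^ 5 + 1)
  have := card_le_of_subset_linkBreaks G R x₀ hR s hs
  rw [hc] at this
  push_cast at this
  linarith

end

end SocialHK

theorem mainTheorem7 :
    (∃ C : ℝ, 0 < C ∧
      ∀ (n : ℕ) (G : SimpleGraph (Fin n)) (R : ℝ), 0 < R → ∀ x₀ : Fin n → ℝ,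
        (SocialHK.linkBreaks G R x₀).Finite ∧
          ((SocialHK.linkBreaks G R x₀).ncard : ℝ) ≤ C * (n : ℝ) ^ 5) ∧
    (∀ (n : ℕ) (G : SimpleGraph (Fin n)) (R : ℝ), 0 < R → ∀ (x₀ : Fin n → ℝ)
      (i j : Fin n) (k : ℕ), SocialHK.LinkBreak G R x₀ i j (k + 1) →
        R ^ 2 / (2 * (n : ℝ) ^ 3) ≤
          SocialHK.energy G R (SocialHK.state G R x₀ k) -
            SocialHK.energy G R (SocialHK.state G R x₀ (k + 1))) := by
  refine ⟨⟨15, by norm_num, fun n G R hR x₀ => ?_⟩, fun n G R hR x₀ i j k h => ?_⟩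
  · have hf := SocialHK.finite_linkBreaks G R x₀ hR
    refine ⟨hf, ?_⟩
    rw [Set.ncard_eq_toFinset_card _ hf]
    exact SocialHK.card_le_of_subset_linkBreaks G R x₀ hR _ (by simp)
  · obtain ⟨-, h1, h2⟩ := h
    have h3 := SocialHK.sq_le_of_break G R (SocialHK.state G R x₀ k) hR h1 h2
    have hn : (0 : ℝ) < n := by exact_mod_cast Fin.pos i
    refine le_trans ?_ (SocialHK.four_mul_sum_sq_displacement_le G R _ hR)
    rw [div_le_iff₀ (by positivity)]
    linarith
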